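/- Let $d\ge 1$, let $\mathcal T_h$ be a finite conforming triangulation in $\mathbb R^d$ by nondegenerate $d$-simplices, let $\Omega$ be the interior of $\bigcup_{T\in\mathcal T_h}T$, let $k\ge 0$ be a polynomial degree and $h>0$ a mesh size. For $T\in\mathcal T_h$ put $a_T(u,v)=(\nabla u,\nabla v)_T$ and $N^c_T(u,v)=(-\partial_n u,v)_{T\cap\partial\Omega}$ ($n$ the outer unit normal, boundary values in the sense of traces), and let $a=\sum_T a_T$ (the broken form) and $N^c=\sum_T N^c_T$. Let $\mathcal P^k_0(T)$ be the polynomials of degree at most $k$ on $T$ with mean value zero, and let $c_{tr}$ be the trace-inverse constant of the mesh, i.e. the smallest $c\ge 0$ with $h\|\nabla q\|_{\partial T}^2\le c\,\|\nabla q\|_T^2$ for all $T\in\mathcal T_h$ and all polynomials $q$ of degree at most $k$. The lifting $\mathcal L$ is defined elementwise by $\mathcal L(u)|_T=\mathcal L_T(u)\in\mathcal P_0^k(T)$ with $$a_T(\mathcal L_T(u),v)=N^c_T(v,u)\qquad\text{for all } v\in\mathcal P_0^k(T).$$ 1. For every $u\in H^1(\Omega)$ and every $T\in\mathcal T_h$,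 this problem has exactly one solution $\mathcal L_T(u)$, and $$a_T(\mathcal L(u),\mathcal L(u))\le\frac{c_{tr}}{h}\|u\|^2_{T\cap\partial\Omega},\qquad a(\mathcal L(u),\mathcal L(u))\le\frac{c_{tr}}{h}\|u\|^2_{\partial\Omega}.$$ 2. Let $N^s_1(u,v)=\frac1h(u,v)_{\partial\Omega}$ and $N^s_*(u,v)=2a(\mathcal L(u),\mathcal L(v))+N^s_1(u,v)$, and let $A^*(u,v)=a(u,v)+N^c(u,v)+N^c(v,u)+N^s_*(u,v)$ be the form of the modified formulation. Let $|||v|||_A=\sqrt{a(v,v)+N_*^s(v,v)}$, and for $N^s\in\{N^s_*,N^s_1\}$ let $$|||v|||=\sqrt{a(v,v)+N^s(v,v)+h\|\nabla v\|^2_{\partial\Omega}}.$$ Let $V_h$ be the space of continuous functions on $\overline\Omega$ that are polynomials of degree at most $k$ on each $T$. There is a nondecreasing function $C:\mathbb R\to\mathbb R$, independent of $d$, $\mathcal T_h$, $k$ and $h$, such that, for both choices of $N^s$ in the norm $|||\cdot|||$, (B) $|||v_h|||_A\le C(c_{tr})\,|||v_h|||$ and $|||v_h|||\le C(c_{tr})\,|||v_h|||_A$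 for all $v_h\in V_h$; (C) $|A^*(u,v)|\le C(c_{tr})\,|||u|||\;|||v|||$ for all $u,v\in V_h+H^2(\Omega)$. -/

import Mathlib

open MeasureTheory Set Filter Topology
open scoped ContDiff ENNReal RealInnerProductSpace

noncomputable section

namespace Nitsche

/-- Euclidean space of dimension `d`. -/
abbrev Euc (d : ℕ) : Type := EuclideanSpace ℝ (Fin d)

/-! ### Sobolev spaces through weak derivatives -/

/-- `G` is a weak gradient of `u` on the open set `U`. -/
def IsWeakGradient {d : ℕ} (U : Set (Euc d)) (u : Euc d → ℝ) (G : Euc d → Euc d) : Prop :=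
  ∀ φ : Euc d → ℝ, ContDiff ℝ ∞ φ → HasCompactSupport φ → tsupport φ ⊆ U →
    ∀ w : Euc d, ∫ x in U, u x * fderiv ℝ φ x w = - ∫ x in U, ⟪G x, w⟫ * φ x

/-- `u ∈ H¹(U)`. -/
def MemH1 {d : ℕ} (U : Set (Euc d)) (u : Euc d → ℝ) : Prop :=
  MemLp u 2 (volume.restrict U) ∧
    ∃ G : Euc d → Euc d, MemLp G 2 (volume.restrict U) ∧ IsWeakGradient U u G

open Classical in
/-- The weak gradient on `U` (a representative of it; it is unique almost everywhere on `U`). -/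
def weakGrad {d : ℕ} (U : Set (Euc d)) (u : Euc d → ℝ) : Euc d → Euc d :=
  if hu : ∃ G : Euc d → Euc d, MemLp G 2 (volume.restrict U) ∧ IsWeakGradient U u G
  then hu.choose else 0

/-- `u ∈ H²(U)`. -/
def MemH2 {d : ℕ} (U : Set (Euc d)) (u : Euc d → ℝ) : Prop :=
  MemH1 U u ∧ ∀ i : Fin d, MemH1 U (fun x => weakGrad U u x i)

/-! ### Simplicial triangulations -/

/-- A conforming simplicial triangulation in `ℝᵈ`: a finite geometric simplicial complex all of
whose faces are faces of `d`-dimensional simplices. -/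
structure Triangulation (d : ℕ) extends Geometry.SimplicialComplex ℝ (Euc d) where
  finite_faces : faces.Finite
  pure_dim : ∀ s ∈ faces, ∃ t ∈ faces, s ⊆ t ∧ t.card = d + 1

/-- The elements of the mesh (each one given by its set of `d + 1` vertices). -/
def Triangulation.elements {d : ℕ} (K : Triangulation d) : Finset (Finset (Euc d)) :=
  {s ∈ K.finite_faces.toFinset | s.card = d + 1}

/-- The triangulated (open, polyhedral) domain `Ω`. -/
def Triangulation.domain {d : ℕ} (K : Triangulation d) : Set (Euc d) :=
  interior K.toSimplicialComplex.space

/-- The simplex with vertex set `s`. -/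
def simplex {d : ℕ} (s : Finset (Euc d)) : Set (Euc d) := convexHull ℝ (s : Set (Euc d))

/-- The interior of the simplex with vertex set `s`. -/
def openSimplex {d : ℕ} (s : Finset (Euc d)) : Set (Euc d) := interior (simplex s)

/-- The facet of the simplex opposite to the vertex `p`. -/
def facet {d : ℕ} (s : Finset (Euc d)) (p : Euc d) : Set (Euc d) :=
  convexHull ℝ ((s : Set (Euc d)) \ {p})

/-- The boundary of the simplex, as the union of its facets. -/
def simplexBoundary {d : ℕ} (s : Finset (Euc d)) : Set (Euc d) := ⋃ p ∈ s, facet s p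

/-- The outer unit normal on the facet opposite to `p`: the normalized component, orthogonal to
that facet, of the vector that points from `p` to the barycentre of the simplex. -/
def outerNormal {d : ℕ} (s : Finset (Euc d)) (p : Euc d) : Euc d :=
  NormedSpace.normalize
    ((vectorSpan ℝ ((s : Set (Euc d)) \ {p}))ᗮ.starProjection (s.centroid ℝ id - p))

/-- The `(d - 1)`-dimensional surface measure. -/
def surfaceMeasure (d : ℕ) : Measure (Euc d) := Measure.euclideanHausdorffMeasure (d - 1)

/-! ### Traces on the boundary of a simplex -/

/-- `g ∈ L²(∂T)` is the trace of `u` on the boundary of the simplex `T`: at almost every boundary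
point `x`, the mean value of `|u - g x|` over `T ∩ B(x, r)` tends to `0` with `r`. -/
def IsTrace {d : ℕ} (s : Finset (Euc d)) (u g : Euc d → ℝ) : Prop :=
  MemLp g 2 ((surfaceMeasure d).restrict (simplexBoundary s)) ∧
    ∀ᵐ x ∂((surfaceMeasure d).restrict (simplexBoundary s)),
      Tendsto (fun r : ℝ => ⨍⁻ y in Metric.ball x r ∩ openSimplex s, ‖u y - g x‖ₑ ∂volume)
        (𝓝[>] 0) (𝓝 0)

open Classical in
/-- The trace of `u` on the boundary of the simplex; every `u` in `H¹` of the simplex has one, and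
it is unique almost everywhere. -/
def trace {d : ℕ} (s : Finset (Euc d)) (u : Euc d → ℝ) : Euc d → ℝ :=
  if hu : ∃ g : Euc d → ℝ, IsTrace s u g then hu.choose else 0

/-- The (componentwise) trace of the gradient `∇u` on the boundary of the simplex. -/
def gradTrace {d : ℕ} (s : Finset (Euc d)) (u : Euc d → ℝ) (x : Euc d) : Euc d :=
  WithLp.toLp 2 fun i => trace s (fun y => weakGrad (openSimplex s) u y i) x

/-! ### The bilinear forms

An integral over `T ∩ ∂Ω` is written as the sum over the facets `F` of `T` of the integrals over
`F ∩ ∂Ω`; two facets overlap in a set of surface measure zero only. Likewise an integral over `∂Ω`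
is the sum over the elements `T` of the integrals over `T ∩ ∂Ω`. -/

section Forms

variable {d : ℕ}

/-- `a_T(u, v) = (∇u, ∇v)_T`. -/
def aT (s : Finset (Euc d)) (u v : Euc d → ℝ) : ℝ :=
  ∫ x in openSimplex s, ⟪weakGrad (openSimplex s) u x, weakGrad (openSimplex s) v x⟫

/-- `N^c_T(u, v) = (-∂ₙu, v)_{T ∩ ∂Ω}`. -/
def NcT (K : Triangulation d) (s : Finset (Euc d)) (u v : Euc d → ℝ) : ℝ :=
  ∑ p ∈ s, ∫ x in facet s p ∩ frontier K.domain,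
    (-⟪gradTrace s u x, outerNormal s p⟫) * trace s v x ∂(surfaceMeasure d)

/-- `(u, v)_{T ∩ ∂Ω}`. -/
def bdryT (K : Triangulation d) (s : Finset (Euc d)) (u v : Euc d → ℝ) : ℝ :=
  ∑ p ∈ s, ∫ x in facet s p ∩ frontier K.domain, trace s u x * trace s v x ∂(surfaceMeasure d)

/-- `‖∇u‖²_{T ∩ ∂Ω}`. -/
def gradBdrySqT (K : Triangulation d) (s : Finset (Euc d)) (u : Euc d → ℝ) : ℝ :=
  ∑ p ∈ s, ∫ x in facet s p ∩ frontier K.domain, ‖gradTrace s u x‖ ^ 2 ∂(surfaceMeasure d)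

/-- `‖∇u‖²_{∂T}`, over the whole boundary of the element. -/
def gradWholeBdrySqT (s : Finset (Euc d)) (u : Euc d → ℝ) : ℝ :=
  ∑ p ∈ s, ∫ x in facet s p, ‖gradTrace s u x‖ ^ 2 ∂(surfaceMeasure d)

/-- The broken form `a(u, v) = ∑_T (∇u, ∇v)_T`. -/
def aForm (K : Triangulation d) (u v : Euc d → ℝ) : ℝ := ∑ s ∈ K.elements, aT s u v

/-- `N^c(u, v) = (-∂ₙu, v)_{∂Ω}`. -/
def Nc (K : Triangulation d) (u v : Euc d → ℝ) : ℝ := ∑ s ∈ K.elements, NcT K s u v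

/-- `(u, v)_{∂Ω}`. -/
def bdry (K : Triangulation d) (u v : Euc d → ℝ) : ℝ := ∑ s ∈ K.elements, bdryT K s u v

/-- `‖∇u‖²_{∂Ω}`. -/
def gradBdrySq (K : Triangulation d) (u : Euc d → ℝ) : ℝ := ∑ s ∈ K.elements, gradBdrySqT K s u

/-! ### Polynomials, the trace inverse constant and the lifting -/

/-- The function on `ℝᵈ` given by a polynomial in `d` variables. -/
def polyFun (q : MvPolynomial (Fin d) ℝ) (x : Euc d) : ℝ := MvPolynomial.eval (fun i => x i) q

/-- The trace inverse constant `c_tr` of the mesh for degree `k` and mesh size `h`: the smallest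
`c ≥ 0` with `h ‖∇q‖²_{∂T} ≤ c ‖∇q‖²_T` for all elements `T` and all `q ∈ 𝒫ᵏ(T)`. -/
def traceInvConst (K : Triangulation d) (k : ℕ) (h : ℝ) : ℝ :=
  sInf {c : ℝ | 0 ≤ c ∧ ∀ s ∈ K.elements, ∀ q : MvPolynomial (Fin d) ℝ, q.totalDegree ≤ k →
    h * gradWholeBdrySqT s (polyFun q) ≤ c * aT s (polyFun q) (polyFun q)}

/-- `q ∈ 𝒫₀ᵏ(T)`: polynomials of degree at most `k` that are `L²(T)`-orthogonal to constants. -/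
def IsP0 (k : ℕ) (s : Finset (Euc d)) (q : MvPolynomial (Fin d) ℝ) : Prop :=
  q.totalDegree ≤ k ∧ ∫ x in simplex s, polyFun q x = 0

/-- `q = ℒ_T(u)`, i.e. `q ∈ 𝒫₀ᵏ(T)` and `a_T(q, v) = N^c_T(v, u)` for all `v ∈ 𝒫₀ᵏ(T)`. On an
element without a facet on `∂Ω` the right-hand side vanishes, and so does `ℒ_T(u)`. -/
def IsLocalLifting (K : Triangulation d) (k : ℕ) (s : Finset (Euc d)) (u : Euc d → ℝ)
    (q : MvPolynomial (Fin d) ℝ) : Prop :=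
  IsP0 k s q ∧ ∀ v : MvPolynomial (Fin d) ℝ, IsP0 k s v →
    aT s (polyFun q) (polyFun v) = NcT K s (polyFun v) u

open Classical in
/-- The local lifting `ℒ_T(u)`. -/
def localLifting (K : Triangulation d) (k : ℕ) (s : Finset (Euc d)) (u : Euc d → ℝ) :
    MvPolynomial (Fin d) ℝ :=
  if hu : ∃ q : MvPolynomial (Fin d) ℝ, IsLocalLifting K k s u q then hu.choose else 0

/-- The global lifting `ℒ(u)`, with `ℒ(u) = ℒ_T(u)` in each (open) element `T`. -/
def lifting (K : Triangulation d) (k : ℕ) (u : Euc d → ℝ) (x : Euc d) : ℝ :=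
  ∑ s ∈ K.elements, (openSimplex s).indicator (polyFun (localLifting K k s u)) x

/-! ### The modified formulation -/

/-- The finite element space `V_h` of continuous piecewise polynomials of degree at most `k`. -/
def MemVh (K : Triangulation d) (k : ℕ) (v : Euc d → ℝ) : Prop :=
  ContinuousOn v (closure K.domain) ∧
    ∀ s ∈ K.elements, ∃ q : MvPolynomial (Fin d) ℝ, q.totalDegree ≤ k ∧
      ∀ x ∈ simplex s, v x = polyFun q x

/-- `u ∈ V_h + H²(Ω)`. -/
def MemVhAddH2 (K : Triangulation d) (k : ℕ) (u : Euc d → ℝ) : Prop :=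
  ∃ v w : Euc d → ℝ, MemVh K k v ∧ MemH2 K.domain w ∧ u = v + w

/-- The penalty form `N^s_1(u, v) = h⁻¹ (u, v)_{∂Ω}`. -/
def penalty (K : Triangulation d) (h : ℝ) (u v : Euc d → ℝ) : ℝ := 1 / h * bdry K u v

/-- The stabilization of the modified formulation, `N^s(u, v) = 2 a(ℒu, ℒv) + N^s_1(u, v)`. -/
def modifiedStab (K : Triangulation d) (k : ℕ) (h : ℝ) (u v : Euc d → ℝ) : ℝ :=
  2 * aForm K (lifting K k u) (lifting K k v) + penalty K h u v

/-- `A*(u, v) = a(u, v) + N^c(u, v) + N^c(v, u) + N^s(u, v)`, with the modified stabilization. -/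
def Astar (K : Triangulation d) (k : ℕ) (h : ℝ) (u v : Euc d → ℝ) : ℝ :=
  aForm K u v + Nc K u v + Nc K v u + modifiedStab K k h u v

/-- `|||v|||_A = √(a(v, v) + N^s(v, v))`, for a stabilization form `N^s`. -/
def normA (K : Triangulation d) (Ns : (Euc d → ℝ) → (Euc d → ℝ) → ℝ) (v : Euc d → ℝ) : ℝ :=
  √(aForm K v v + Ns v v)

/-- The stronger norm `|||v|||`, with `|||v|||² = |||v|||²_A + h ‖∇v‖²_{∂Ω}`. -/
def normStrong (K : Triangulation d) (h : ℝ) (Ns : (Euc d → ℝ) → (Euc d → ℝ) → ℝ)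
    (v : Euc d → ℝ) : ℝ :=
  √(normA K Ns v ^ 2 + h * gradBdrySq K v)

end Forms

end Nitsche

end

/-!
The theorem is a consequence of linear algebra on the finite-dimensional spaces `𝒫₀ᵏ(T)` and of
the Cauchy-Schwarz inequality, once the weak notions are identified with the classical ones on
polynomials.

On polynomials, the weak gradient is the classical gradient (`weakGrad_ae_eq_polyGrad`), by
integration by parts and the uniqueness of weak gradients, and the trace of the gradient is its
restriction to the boundary (`gradTrace_ae_eq_polyGrad`), by the uniqueness of traces and the
finiteness of the surface measure of a facet (`surfaceMeasure_facet_lt_top`). Hence `a_T` is an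
inner product on `𝒫₀ᵏ(T)` (`eq_zero_of_elementForm_self_eq_zero`) and `v ↦ N^c_T(v, u)` is a
linear functional there (`exists_linearMap_eq_NcT`); this gives the unique solvability of the
local problem (`existsUnique_isLocalLifting`). Since a quadratic form on a finite-dimensional
space is bounded by any inner product, and the mesh is finite, the trace inverse constant is
finite, and the inequality that defines it holds with the constant itself (`trace_inverse`).

Testing the local problem with its solution `q` gives `‖∇q‖²_T = N^c_T(q, u) ≤ ‖∇q‖_{∂T} ‖u‖_{T
∩ ∂Ω} ≤ (c_tr / h)^{1/2} ‖∇q‖_T ‖u‖_{T ∩ ∂Ω}`, which is the estimate of the lifting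
(`aT_lifting_le`). The lifting part of the modified stabilization is therefore at most `2 c_tr`
times the penalty form. On `V_h` the trace inverse inequality bounds `h ‖∇v‖²_{∂Ω}` by `c_tr
a(v, v)`, so that the norms are equivalent with constants `(1 + 2 c_tr)^{1/2}` and `(1 +
c_tr)^{1/2}`. For the continuity of `A*`, the weak gradients and the traces are square
integrable, each of the five terms is bounded by the Cauchy-Schwarz inequality, and in the
consistency terms the weights `h` and `h⁻¹` cancel; the sum of the bounds is `4 + 2 c_tr`
(`abs_Astar_le`).
-/

namespace Nitsche

/-! ### The Cauchy-Schwarz inequality for integrals and finite sums -/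

section CauchySchwarz

variable {α E : Type*} [MeasurableSpace α] {μ : Measure α}
  [NormedAddCommGroup E] [InnerProductSpace ℝ E]

lemma integrable_inner_of_memLp {F G : α → E} (hF : MemLp F 2 μ) (hG : MemLp G 2 μ) :
    Integrable (fun x => ⟪F x, G x⟫) μ := by
  refine (L2.integrable_inner (𝕜 := ℝ) (hF.toLp F) (hG.toLp G)).congr ?_
  filter_upwards [hF.coeFn_toLp, hG.coeFn_toLp] with x h1 h2
  rw [h1, h2]

lemma abs_integral_inner_le {F G : α → E} (hF : MemLp F 2 μ) (hG : MemLp G 2 μ) :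
    |∫ x, ⟪F x, G x⟫ ∂μ| ≤ √(∫ x, ‖F x‖ ^ 2 ∂μ) * √(∫ x, ‖G x‖ ^ 2 ∂μ) := by
  have key : ∀ {F G : α → E} (hF : MemLp F 2 μ) (hG : MemLp G 2 μ),
      ⟪hF.toLp F, hG.toLp G⟫ = ∫ x, ⟪F x, G x⟫ ∂μ := by
    intro F G hF hG
    rw [L2.inner_def]
    refine integral_congr_ae ?_
    filter_upwards [hF.coeFn_toLp, hG.coeFn_toLp] with x h1 h2
    rw [h1, h2]
  have hn : ∀ {F : α → E} (hF : MemLp F 2 μ), ‖hF.toLp F‖ = √(∫ x, ‖F x‖ ^ 2 ∂μ) := by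
    intro F hF
    rw [norm_eq_sqrt_real_inner, key hF hF]
    simp_rw [real_inner_self_eq_norm_sq]
  rw [← key hF hG, ← hn hF, ← hn hG]
  exact abs_real_inner_le_norm _ _

lemma abs_integral_mul_le {f g : α → ℝ} (hf : MemLp f 2 μ) (hg : MemLp g 2 μ) :
    |∫ x, f x * g x ∂μ| ≤ √(∫ x, f x ^ 2 ∂μ) * √(∫ x, g x ^ 2 ∂μ) := by
  simpa [mul_comm] using abs_integral_inner_le hf hg

lemma abs_sum_le_sqrt_mul_sqrt {ι : Type*} (S : Finset ι) {x a b : ι → ℝ}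
    (ha : ∀ i ∈ S, 0 ≤ a i) (hb : ∀ i ∈ S, 0 ≤ b i) (h : ∀ i ∈ S, |x i| ≤ √(a i) * √(b i)) :
    |∑ i ∈ S, x i| ≤ √(∑ i ∈ S, a i) * √(∑ i ∈ S, b i) := by
  have h2 := Real.sum_sqrt_mul_sqrt_le (f := fun i : S => a i) (g := fun i : S => b i)
    Finset.univ (fun i => ha i i.2) (fun i => hb i i.2)
  rw [Finset.univ_eq_attach, Finset.sum_attach S (fun i => √(a i) * √(b i)),
    Finset.sum_attach S a, Finset.sum_attach S b] at h2
  exact ((Finset.abs_sum_le_sum_abs _ _).trans (Finset.sum_le_sum h)).trans h2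

end CauchySchwarz

/-! ### Simplices -/

section Geometry

variable {d : ℕ}

lemma isCompact_simplex (s : Finset (Euc d)) : IsCompact (simplex s) :=
  s.finite_toSet.isCompact_convexHull ℝ

lemma isCompact_facet (s : Finset (Euc d)) (p : Euc d) : IsCompact (facet s p) :=
  (s.finite_toSet.subset sdiff_subset).isCompact_convexHull ℝ

lemma isCompact_simplexBoundary (s : Finset (Euc d)) : IsCompact (simplexBoundary s) :=
  s.isCompact_biUnion fun p _ => isCompact_facet s p

lemma facet_subset_simplexBoundary {s : Finset (Euc d)} {p : Euc d} (hp : p ∈ s) :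
    facet s p ⊆ simplexBoundary s :=
  subset_biUnion_of_mem (u := fun p => facet s p) hp

lemma simplexBoundary_subset_simplex (s : Finset (Euc d)) : simplexBoundary s ⊆ simplex s :=
  iUnion₂_subset fun _ _ => convexHull_mono sdiff_subset

lemma convex_openSimplex (s : Finset (Euc d)) : Convex ℝ (openSimplex s) :=
  (convex_convexHull ℝ _).interior

lemma isOpen_openSimplex (s : Finset (Euc d)) : IsOpen (openSimplex s) := isOpen_interior

lemma openSimplex_subset_simplex (s : Finset (Euc d)) : openSimplex s ⊆ simplex s :=
  interior_subset

variable {K : Triangulation d} {s t : Finset (Euc d)}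

lemma mem_elements : s ∈ K.elements ↔ s ∈ K.faces ∧ s.card = d + 1 := by
  simp [Triangulation.elements]

lemma openSimplex_nonempty (hs : s ∈ K.elements) : (openSimplex s).Nonempty := by
  obtain ⟨hf, hc⟩ := mem_elements.1 hs
  rw [openSimplex, simplex, interior_convexHull_nonempty_iff_affineSpan_eq_top]
  have := (K.indep hf).affineSpan_eq_top_iff_card_eq_finrank_add_one
  simpa [hc] using this

/-- Distinct elements of a conforming mesh meet in a common proper face, so their interiors are
disjoint. -/
lemma disjoint_openSimplex (hs : s ∈ K.elements) (ht : t ∈ K.elements) (hst : s ≠ t) :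
    Disjoint (openSimplex s) (openSimplex t) := by
  classical
  obtain ⟨hsf, hsc⟩ := mem_elements.1 hs
  obtain ⟨htf, htc⟩ := mem_elements.1 ht
  rw [disjoint_iff_inter_eq_empty, openSimplex, openSimplex, ← interior_inter,
    ← not_nonempty_iff_eq_empty]
  intro hne
  have hne' := hne.mono (interior_mono (K.inter_subset_convexHull hsf htf))
  rw [interior_convexHull_nonempty_iff_affineSpan_eq_top, ← Finset.coe_inter] at hne'
  have hlt : (s ∩ t).card < d + 1 := by
    rw [← hsc]
    refine Finset.card_lt_card ⟨Finset.inter_subset_left, fun h => hst ?_⟩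
    exact Finset.eq_of_subset_of_card_le (fun x hx => (Finset.mem_inter.1 (h hx)).2)
      (by rw [hsc, htc])
  have hind : AffineIndependent ℝ ((↑) : ↥(s ∩ t) → Euc d) :=
    AffineIndependent.mono (t := (s : Set (Euc d))) (K.indep hsf) (by simp)
  have := hind.affineSpan_eq_top_iff_card_eq_finrank_add_one.1
    (by rw [Subtype.range_coe]; exact hne')
  rw [Fintype.card_coe, finrank_euclideanSpace_fin] at this
  omega

/-- A facet spans an affine subspace of dimension `d - 1`, on which the surface measure is Lebesgue
measure up to an isometry; hence the bounded facet has finite surface measure. -/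
lemma surfaceMeasure_facet_lt_top (hd : 1 ≤ d) (hs : s ∈ K.elements) {p : Euc d} (hp : p ∈ s) :
    surfaceMeasure d (facet s p) < ⊤ := by
  classical
  obtain ⟨hf, hc⟩ := mem_elements.1 hs
  have hcard : (s.erase p).card = (d - 1) + 1 := by
    rw [Finset.card_erase_of_mem hp, hc]; omega
  have hcoe : ((s : Set (Euc d)) \ {p}) = ((s.erase p : Finset (Euc d)) : Set (Euc d)) := by simp
  have hind : AffineIndependent ℝ ((↑) : ↥(s.erase p) → Euc d) :=
    AffineIndependent.mono (t := (s : Set (Euc d))) (K.indep hf) (by simp)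
  obtain ⟨q, hq⟩ : (s.erase p).Nonempty := Finset.card_pos.1 (by omega)
  set A : AffineSubspace ℝ (Euc d) := affineSpan ℝ ((s.erase p : Finset (Euc d)) : Set (Euc d))
    with hA
  have hqA : q ∈ A := subset_affineSpan ℝ _ hq
  have : Nonempty A := ⟨⟨q, hqA⟩⟩
  have hfin : Module.finrank ℝ A.direction = d - 1 := by
    rw [hA, direction_affineSpan]
    have h := hind.finrank_vectorSpan (n := d - 1) (by rw [Fintype.card_coe, hcard])
    have hr : range ((↑) : ↥(s.erase p) → Euc d) = ((s.erase p : Finset (Euc d)) : Set (Euc d)) :=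
      Subtype.range_coe
    exact hr ▸ h
  have hsub : facet s p ⊆ A := by
    rw [facet, hcoe]; exact convexHull_subset_affineSpan _
  have himg : facet s p = Subtype.val '' ((Subtype.val : A → Euc d) ⁻¹' facet s p) := by
    refine (image_preimage_eq_of_subset fun x hx => ?_).symm
    exact ⟨⟨x, hsub hx⟩, rfl⟩
  have hcomp : IsCompact ((Subtype.val : A → Euc d) ⁻¹' facet s p) := by
    refine Topology.IsInducing.subtypeVal.isCompact_preimage_iff ?_ |>.2 (isCompact_facet s p)
    simpa using hsub
  rw [surfaceMeasure, himg, AffineSubspace.euclideanHausdorffMeasure_coe_image, ← hfin,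
    EuclideanGeometry.euclideanHausdorffMeasure_eq (⟨q, hqA⟩ : A)]
  set e := IsometryEquiv.vaddConst (V := A.direction) (⟨q, hqA⟩ : A)
  rw [Measure.map_apply e.continuous.measurable hcomp.measurableSet]
  refine IsCompact.measure_lt_top ?_
  exact e.toHomeomorph.isCompact_preimage.2 hcomp

lemma isFiniteMeasure_simplexBoundary (hd : 1 ≤ d) (hs : s ∈ K.elements) :
    IsFiniteMeasure ((surfaceMeasure d).restrict (simplexBoundary s)) := by
  refine ⟨?_⟩
  rw [Measure.restrict_apply_univ, simplexBoundary]
  exact (measure_biUnion_finset_le s _).trans_lt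
    (ENNReal.sum_lt_top.2 fun p hp => surfaceMeasure_facet_lt_top hd hs hp)

lemma isFiniteMeasure_openSimplex (s : Finset (Euc d)) :
    IsFiniteMeasure ((volume : Measure (Euc d)).restrict (openSimplex s)) :=
  ⟨by rw [Measure.restrict_apply_univ]
      exact (measure_mono (openSimplex_subset_simplex s)).trans_lt
        (isCompact_simplex s).measure_lt_top⟩

lemma memLp_of_continuous {E : Type*} [NormedAddCommGroup E] [SecondCountableTopology E]
    {μ : Measure (Euc d)} {S T : Set (Euc d)}
    (hT : IsCompact T) (hST : S ⊆ T) (hS : MeasurableSet S) [IsFiniteMeasure (μ.restrict S)]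
    {f : Euc d → E} (hf : Continuous f) : MemLp f 2 (μ.restrict S) := by
  obtain ⟨C, hC⟩ := hT.exists_bound_of_continuousOn hf.continuousOn
  refine MemLp.of_bound hf.stronglyMeasurable.aestronglyMeasurable C ?_
  filter_upwards [ae_restrict_mem hS] with x hx using hC x (hST hx)

lemma memLp_openSimplex {E : Type*} [NormedAddCommGroup E] [SecondCountableTopology E]
    (s : Finset (Euc d)) {f : Euc d → E} (hf : Continuous f) :
    MemLp f 2 (volume.restrict (openSimplex s)) :=
  have := isFiniteMeasure_openSimplex s
  memLp_of_continuous (isCompact_simplex s) (openSimplex_subset_simplex s)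
    (isOpen_openSimplex s).measurableSet hf

lemma memLp_simplexBoundary (hd : 1 ≤ d) (hs : s ∈ K.elements)
    {E : Type*} [NormedAddCommGroup E] [SecondCountableTopology E]
    {f : Euc d → E} (hf : Continuous f) :
    MemLp f 2 ((surfaceMeasure d).restrict (simplexBoundary s)) :=
  have := isFiniteMeasure_simplexBoundary hd hs
  memLp_of_continuous (isCompact_simplexBoundary s) subset_rfl
    (isCompact_simplexBoundary s).measurableSet hf

end Geometry

/-! ### Polynomials and their gradients -/

section Polynomials

open MvPolynomial

variable {d : ℕ}

/-- The classical gradient of a polynomial. -/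
noncomputable def polyGrad (q : MvPolynomial (Fin d) ℝ) (x : Euc d) : Euc d :=
  WithLp.toLp 2 fun i => polyFun (pderiv i q) x

lemma polyFun_add (p q : MvPolynomial (Fin d) ℝ) (x : Euc d) :
    polyFun (p + q) x = polyFun p x + polyFun q x := by simp [polyFun]

lemma polyFun_smul (c : ℝ) (q : MvPolynomial (Fin d) ℝ) (x : Euc d) :
    polyFun (c • q) x = c * polyFun q x := by simp [polyFun, smul_eval]

lemma polyGrad_add (p q : MvPolynomial (Fin d) ℝ) (x : Euc d) :
    polyGrad (p + q) x = polyGrad p x + polyGrad q x := by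
  ext i; simp [polyGrad, polyFun_add]

lemma polyGrad_smul (c : ℝ) (q : MvPolynomial (Fin d) ℝ) (x : Euc d) :
    polyGrad (c • q) x = c • polyGrad q x := by
  ext i; simp [polyGrad, polyFun_smul]

lemma hasFDerivAt_polyFun (q : MvPolynomial (Fin d) ℝ) (x : Euc d) :
    HasFDerivAt (polyFun q) (innerSL ℝ (polyGrad q x)) x := by
  induction q using MvPolynomial.induction_on with
  | C a =>
    have h1 : polyFun (C a : MvPolynomial (Fin d) ℝ) = fun _ => a := by ext y; simp [polyFun]
    have h2 : polyGrad (C a : MvPolynomial (Fin d) ℝ) x = 0 := by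
      ext i; simp [polyGrad, polyFun]
    rw [h1, h2, map_zero]
    exact hasFDerivAt_const a x
  | add p q hp hq =>
    have h1 : polyFun (p + q) = polyFun p + polyFun q := by ext y; simp [polyFun]
    rw [h1, polyGrad_add, map_add]
    exact hp.add hq
  | mul_X p j hp =>
    have h1 : polyFun (p * X j) = fun y => polyFun p y * y j := by ext y; simp [polyFun]
    have hX : HasFDerivAt (fun y : Euc d => y j) (EuclideanSpace.proj (𝕜 := ℝ) j) x :=
      (EuclideanSpace.proj (𝕜 := ℝ) j).hasFDerivAt
    rw [h1]
    refine (hp.mul hX).congr_fderiv ?_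
    ext v
    have h2 : polyGrad (p * X j) x = polyFun p x • EuclideanSpace.single j (1 : ℝ)
        + x j • polyGrad p x := by
      ext i
      by_cases hij : j = i
      · subst hij
        simp [polyGrad, polyFun, Derivation.leibniz]
      · simp [polyGrad, polyFun, Derivation.leibniz, pderiv_X, Pi.single_apply, hij, Ne.symm hij]
    rw [h2]
    simp [EuclideanSpace.inner_single_left]

lemma continuous_polyFun (q : MvPolynomial (Fin d) ℝ) : Continuous (polyFun q) :=
  continuous_iff_continuousAt.2 fun x => (hasFDerivAt_polyFun q x).continuousAt

lemma continuous_polyGrad (q : MvPolynomial (Fin d) ℝ) : Continuous (polyGrad q) :=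
  (PiLp.continuous_toLp 2 _).comp (continuous_pi fun i => continuous_polyFun (pderiv i q))

lemma fderiv_polyFun (q : MvPolynomial (Fin d) ℝ) (x w : Euc d) :
    fderiv ℝ (polyFun q) x w = ⟪polyGrad q x, w⟫ := by
  rw [(hasFDerivAt_polyFun q x).fderiv]; rfl

lemma eq_zero_of_polyFun_eqOn_zero {U : Set (Euc d)} (hU : IsOpen U) (hne : U.Nonempty)
    {q : MvPolynomial (Fin d) ℝ} (h : ∀ x ∈ U, polyFun q x = 0) : q = 0 := by
  obtain ⟨x₀, hx₀⟩ := hne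
  -- An open set contains a box, on which a nonzero polynomial cannot vanish.
  have hV : IsOpen ((WithLp.toLp 2 : (Fin d → ℝ) → Euc d) ⁻¹' U) :=
    hU.preimage (PiLp.continuous_toLp 2 _)
  obtain ⟨ε, hε, hball⟩ := Metric.isOpen_iff.1 hV (WithLp.ofLp x₀) hx₀
  refine MvPolynomial.funext_set (fun i => Metric.ball (x₀ i) ε) (fun i => ?_) fun x hx => ?_
  · rw [Real.ball_eq_Ioo]
    exact Ioo_infinite (by linarith)
  · rw [map_zero]
    refine h (WithLp.toLp 2 x) (hball ?_)
    rw [ball_pi _ hε]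
    exact hx

end Polynomials

/-! ### Weak gradients -/

section WeakGradient

variable {d : ℕ} {U : Set (Euc d)} {u v : Euc d → ℝ}

lemma memLp_weakGrad (U : Set (Euc d)) (u : Euc d → ℝ) :
    MemLp (weakGrad U u) 2 (volume.restrict U) := by
  unfold weakGrad
  split_ifs with h
  · exact h.choose_spec.1
  · exact MemLp.zero

lemma isWeakGradient_weakGrad {G : Euc d → Euc d} (hG : MemLp G 2 (volume.restrict U))
    (h : IsWeakGradient U u G) : IsWeakGradient U u (weakGrad U u) := by
  have hex : ∃ G : Euc d → Euc d, MemLp G 2 (volume.restrict U) ∧ IsWeakGradient U u G :=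
    ⟨G, hG, h⟩
  rw [weakGrad, dif_pos hex]
  exact hex.choose_spec.2

lemma IsWeakGradient.congr {G : Euc d → Euc d} (h : IsWeakGradient U u G)
    (huv : u =ᵐ[volume.restrict U] v) : IsWeakGradient U v G := by
  intro φ h1 h2 h3 w
  rw [← h φ h1 h2 h3 w]
  refine integral_congr_ae ?_
  filter_upwards [huv] with x hx
  rw [hx]

/-- Weak gradients are unique almost everywhere, by the fundamental lemma of the calculus of
variations. -/
lemma IsWeakGradient.ae_eq (hU : IsOpen U) {G G' : Euc d → Euc d}
    (hG : MemLp G 2 (volume.restrict U)) (hG' : MemLp G' 2 (volume.restrict U))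
    (h : IsWeakGradient U u G) (h' : IsWeakGradient U u G') :
    G =ᵐ[volume.restrict U] G' := by
  have key : ∀ i : Fin d, ∀ᵐ x ∂(volume : Measure (Euc d)), x ∈ U → G x i - G' x i = 0 := by
    intro i
    have hcomp : ∀ {F : Euc d → Euc d}, MemLp F 2 (volume.restrict U) →
        MemLp (fun x => F x i) 2 (volume.restrict U) := fun hF => memLp_piLp_iff.1 hF i
    refine hU.ae_eq_zero_of_integral_contDiff_smul_eq_zero ?_ ?_
    · refine locallyIntegrableOn_of_locallyIntegrable_restrict ?_
      exact ((hcomp hG).sub (hcomp hG')).locallyIntegrable (by norm_num)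
    · intro φ hφ hφc hφU
      have hφ2 : MemLp φ 2 (volume.restrict U) :=
        (hφ.continuous.memLp_of_hasCompactSupport hφc).restrict U
      have e1 := h φ hφ hφc hφU (EuclideanSpace.single i 1)
      have e2 := h' φ hφ hφc hφU (EuclideanSpace.single i 1)
      rw [e1, neg_inj] at e2
      simp only [EuclideanSpace.inner_single_right, one_mul, conj_trivial] at e2
      rw [← setIntegral_eq_integral_of_forall_compl_eq_zero (s := U)]
      · have i1 : Integrable (fun x => G x i * φ x) (volume.restrict U) :=
          (hcomp hG).integrable_mul hφ2
        have i2 : Integrable (fun x => G' x i * φ x) (volume.restrict U) :=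
          (hcomp hG').integrable_mul hφ2
        have : ∀ x, φ x • (G x i - G' x i) = G x i * φ x - G' x i * φ x := by
          intro x; rw [smul_eq_mul]; ring
        simp_rw [this]
        rw [integral_sub i1 i2, e2, sub_self]
      · intro x hx
        rw [image_eq_zero_of_notMem_tsupport (fun hx' => hx (hφU hx')), zero_smul]
  rw [EventuallyEq, ae_restrict_iff' hU.measurableSet]
  filter_upwards [ae_all_iff.2 key] with x hx hxU
  ext i
  exact sub_eq_zero.1 (hx i hxU)

lemma isWeakGradient_polyFun (U : Set (Euc d)) (q : MvPolynomial (Fin d) ℝ) :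
    IsWeakGradient U (polyFun q) (polyGrad q) := by
  intro φ hφ hφc hφU w
  have hφ0 : ∀ x, x ∉ U → φ x = 0 := fun x hx =>
    image_eq_zero_of_notMem_tsupport fun hx' => hx (hφU hx')
  have hdφ0 : ∀ x, x ∉ U → fderiv ℝ φ x w = 0 := fun x hx => by
    rw [fderiv_of_notMem_tsupport ℝ fun hx' => hx (hφU hx')]; rfl
  have hdc : HasCompactSupport fun x => fderiv ℝ φ x w := hφc.fderiv_apply (𝕜 := ℝ) w
  have hdcont : Continuous fun x => fderiv ℝ φ x w :=
    (hφ.continuous_fderiv (by simp)).clm_apply continuous_const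
  rw [setIntegral_eq_integral_of_forall_compl_eq_zero fun x hx => by rw [hdφ0 x hx, mul_zero],
    setIntegral_eq_integral_of_forall_compl_eq_zero fun x hx => by rw [hφ0 x hx, mul_zero]]
  simp_rw [← fderiv_polyFun]
  refine integral_mul_fderiv_eq_neg_fderiv_mul_of_integrable ?_ ?_ ?_
    (fun x _ => (hasFDerivAt_polyFun q x).differentiableAt)
    (fun x _ => hφ.differentiable (by simp) x)
  · simp_rw [fderiv_polyFun]
    exact ((continuous_polyGrad q).inner continuous_const).mul hφ.continuous
      |>.integrable_of_hasCompactSupport hφc.mul_left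
  · exact ((continuous_polyFun q).mul hdcont).integrable_of_hasCompactSupport hdc.mul_left
  · exact ((continuous_polyFun q).mul hφ.continuous).integrable_of_hasCompactSupport hφc.mul_left

/-- A function that is a polynomial in the open simplex has the classical gradient of that
polynomial as its weak gradient there. -/
lemma weakGrad_ae_eq_polyGrad (s : Finset (Euc d)) {q : MvPolynomial (Fin d) ℝ}
    (hu : ∀ x ∈ openSimplex s, u x = polyFun q x) :
    weakGrad (openSimplex s) u =ᵐ[volume.restrict (openSimplex s)] polyGrad q := by
  have hG : MemLp (polyGrad q) 2 (volume.restrict (openSimplex s)) :=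
    memLp_openSimplex s (continuous_polyGrad q)
  have hw : IsWeakGradient (openSimplex s) u (polyGrad q) := by
    refine (isWeakGradient_polyFun _ q).congr ?_
    filter_upwards [ae_restrict_mem (isOpen_openSimplex s).measurableSet] with x hx
    exact (hu x hx).symm
  exact (isWeakGradient_weakGrad hG hw).ae_eq (isOpen_openSimplex s) (memLp_weakGrad _ _) hG hw

end WeakGradient

/-! ### Traces -/

section Trace

variable {d : ℕ} {K : Triangulation d} {s : Finset (Euc d)} {u w : Euc d → ℝ}

lemma memLp_trace (s : Finset (Euc d)) (u : Euc d → ℝ) :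
    MemLp (trace s u) 2 ((surfaceMeasure d).restrict (simplexBoundary s)) := by
  unfold trace
  split_ifs with h
  · exact h.choose_spec.1
  · exact MemLp.zero

lemma memLp_gradTrace (s : Finset (Euc d)) (u : Euc d → ℝ) :
    MemLp (gradTrace s u) 2 ((surfaceMeasure d).restrict (simplexBoundary s)) :=
  memLp_piLp_iff.2 fun _ => memLp_trace s _

lemma volume_ball_inter_openSimplex_ne_zero (hs : s ∈ K.elements) {x : Euc d}
    (hx : x ∈ simplexBoundary s) {r : ℝ} (hr : 0 < r) :
    (volume : Measure (Euc d)) (Metric.ball x r ∩ openSimplex s) ≠ 0 := by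
  have hx' : x ∈ closure (openSimplex s) := by
    have hconv : Convex ℝ (simplex s) := convex_convexHull ℝ _
    rw [openSimplex, hconv.closure_interior_eq_closure_of_nonempty_interior
      (openSimplex_nonempty hs)]
    exact subset_closure (simplexBoundary_subset_simplex s hx)
  obtain ⟨y, hy, hxy⟩ := Metric.mem_closure_iff.1 hx' r hr
  exact ((Metric.isOpen_ball.inter (isOpen_openSimplex s)).measure_pos volume
    ⟨y, by rwa [Metric.mem_ball, dist_comm], hy⟩).ne'

lemma isTrace_of_ae_eq_continuous (hd : 1 ≤ d) (hs : s ∈ K.elements) (hw : Continuous w)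
    (huw : u =ᵐ[volume.restrict (openSimplex s)] w) : IsTrace s u w := by
  refine ⟨memLp_simplexBoundary hd hs hw, Eventually.of_forall fun x => ?_⟩
  rw [ENNReal.tendsto_nhds_zero]
  intro ε hε
  have hcont : ∀ᶠ y in 𝓝 x, ‖w y - w x‖ₑ ≤ ε := by
    have h : Tendsto (fun y => ‖w y - w x‖ₑ) (𝓝 x) (𝓝 0) := by
      have := ((hw.sub continuous_const).enorm (f := fun y => w y - w x)).tendsto x
      simpa using this
    exact ENNReal.tendsto_nhds_zero.1 h ε hε
  obtain ⟨δ, hδ, hball⟩ := Metric.eventually_nhds_iff_ball.1 hcont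
  filter_upwards [Ioo_mem_nhdsGT hδ] with r hr
  rw [setLAverage_eq]
  refine ENNReal.div_le_of_le_mul ?_
  rw [← setLIntegral_const]
  refine lintegral_mono_ae ?_
  filter_upwards [ae_mono (Measure.restrict_mono inter_subset_right le_rfl) huw,
    ae_restrict_mem (measurableSet_ball.inter (isOpen_openSimplex s).measurableSet)] with y hy hyr
  rw [hy]
  exact hball y (Metric.ball_subset_ball hr.2.le hyr.1)

/-- Traces are unique almost everywhere. Measurability of `u` is needed because the lower Lebesgue
integral is subadditive on measurable functions only. -/
lemma IsTrace.ae_eq (hs : s ∈ K.elements)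
    (hu : AEMeasurable u (volume.restrict (openSimplex s))) {g g' : Euc d → ℝ}
    (hg : IsTrace s u g) (hg' : IsTrace s u g') :
    g =ᵐ[(surfaceMeasure d).restrict (simplexBoundary s)] g' := by
  filter_upwards [hg.2, hg'.2, ae_restrict_mem (isCompact_simplexBoundary s).measurableSet]
    with x h1 h2 hx
  have hlim := h1.add h2
  rw [add_zero] at hlim
  have hle : ‖g x - g' x‖ₑ ≤ 0 := by
    refine ge_of_tendsto hlim ?_
    filter_upwards [self_mem_nhdsWithin] with r hr
    have hmeas : AEMeasurable u (volume.restrict (Metric.ball x r ∩ openSimplex s)) :=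
      hu.mono_measure (Measure.restrict_mono inter_subset_right le_rfl)
    have hfin : (volume : Measure (Euc d)) (Metric.ball x r ∩ openSimplex s) ≠ ⊤ :=
      ((measure_mono inter_subset_left).trans_lt measure_ball_lt_top).ne
    rw [← setLAverage_const (volume_ball_inter_openSimplex_ne_zero hs hx hr) hfin ‖g x - g' x‖ₑ,
      setLAverage_eq, setLAverage_eq, setLAverage_eq, ← ENNReal.add_div,
      ← lintegral_add_left' (hmeas.sub_const _).enorm]
    refine ENNReal.div_le_div_right (lintegral_mono fun y => ?_) _
    rw [← enorm_neg (u y - g x)]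
    refine le_trans (le_of_eq ?_) (enorm_add_le _ _)
    congr 1; ring
  exact sub_eq_zero.1 (enorm_eq_zero.1 (le_antisymm hle zero_le))

/-- The trace of a function with a continuous representative is the pointwise restriction of that
representative. -/
lemma trace_ae_eq_of_ae_eq_continuous (hd : 1 ≤ d) (hs : s ∈ K.elements) (hw : Continuous w)
    (huw : u =ᵐ[volume.restrict (openSimplex s)] w) :
    trace s u =ᵐ[(surfaceMeasure d).restrict (simplexBoundary s)] w := by
  have hT := isTrace_of_ae_eq_continuous hd hs hw huw
  have hex : ∃ g : Euc d → ℝ, IsTrace s u g := ⟨w, hT⟩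
  have hch : IsTrace s u (trace s u) := by
    rw [trace, dif_pos hex]; exact hex.choose_spec
  exact hch.ae_eq hs (hw.measurable.aemeasurable.congr huw.symm) hT

lemma gradTrace_ae_eq_polyGrad (hd : 1 ≤ d) (hs : s ∈ K.elements) {q : MvPolynomial (Fin d) ℝ}
    (hu : ∀ x ∈ openSimplex s, u x = polyFun q x) :
    gradTrace s u =ᵐ[(surfaceMeasure d).restrict (simplexBoundary s)] polyGrad q := by
  have h : ∀ i : Fin d, trace s (fun y => weakGrad (openSimplex s) u y i)
      =ᵐ[(surfaceMeasure d).restrict (simplexBoundary s)] polyFun (MvPolynomial.pderiv i q) := by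
    intro i
    refine trace_ae_eq_of_ae_eq_continuous hd hs (continuous_polyFun _) ?_
    filter_upwards [weakGrad_ae_eq_polyGrad s hu] with y hy
    rw [hy, polyGrad]
  filter_upwards [eventually_all.2 h] with x hx
  ext i
  exact hx i

end Trace

/-! ### Positive definite forms on finite-dimensional spaces -/

section FiniteDimensional

lemma exists_forall_le_mul_norm_sq {V : Type*} [NormedAddCommGroup V] [NormedSpace ℝ V]
    [FiniteDimensional ℝ V] (B : V →ₗ[ℝ] V →ₗ[ℝ] ℝ) :
    ∃ C : ℝ, 0 ≤ C ∧ ∀ x, B x x ≤ C * (‖x‖ * ‖x‖) := by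
  refine ⟨‖LinearMap.toContinuousBilinearMap B‖, ContinuousLinearMap.opNorm_nonneg _, fun x => ?_⟩
  have h1 := (LinearMap.toContinuousBilinearMap B).le_opNorm₂ x x
  rw [mul_assoc] at h1
  exact (le_abs_self _).trans h1

variable {V : Type*} [AddCommGroup V] [Module ℝ V] [FiniteDimensional ℝ V]

/-- On a finite-dimensional space every bilinear form is bounded by a given inner product. -/
lemma exists_forall_le_mul_of_posDef (B B' : V →ₗ[ℝ] V →ₗ[ℝ] ℝ) (hsymm : ∀ x y, B x y = B y x)
    (hnonneg : ∀ x, 0 ≤ B x x) (hdef : ∀ x, B x x = 0 → x = 0) :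
    ∃ C : ℝ, 0 ≤ C ∧ ∀ x, B' x x ≤ C * B x x := by
  let core : InnerProductSpace.Core ℝ V :=
    { inner := fun x y => B x y
      conj_inner_symm := fun x y => hsymm y x
      re_inner_nonneg := hnonneg
      add_left := fun x y z => by simp
      smul_left := fun x y r => by simp
      definite := hdef }
  let _ : NormedAddCommGroup V := core.toNormedAddCommGroup
  let _ : InnerProductSpace ℝ V := InnerProductSpace.ofCore core.toCore
  obtain ⟨C, hC0, hC⟩ := exists_forall_le_mul_norm_sq B'
  refine ⟨C, hC0, fun x => ?_⟩
  have h2 : ‖x‖ * ‖x‖ = B x x := (real_inner_self_eq_norm_mul_norm x).symm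
  rw [← h2]
  exact hC x

/-- A definite bilinear form on a finite-dimensional space represents every linear functional. -/
lemma existsUnique_forall_eq_of_definite (B : V →ₗ[ℝ] V →ₗ[ℝ] ℝ)
    (hdef : ∀ x, B x x = 0 → x = 0) (l : V →ₗ[ℝ] ℝ) : ∃! x, ∀ y, B x y = l y := by
  have hinj : Function.Injective B := by
    refine (injective_iff_map_eq_zero B).2 fun x hx => hdef x ?_
    rw [hx, LinearMap.zero_apply]
  have hsurj : Function.Surjective B :=
    (LinearMap.injective_iff_surjective_of_finrank_eq_finrank
      (Subspace.dual_finrank_eq (K := ℝ) (V := V)).symm).1 hinj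
  obtain ⟨x, hx⟩ := hsurj l
  refine ⟨x, fun y => by rw [hx], fun z hz => hinj ?_⟩
  rw [hx]
  exact LinearMap.ext hz

end FiniteDimensional

/-! ### The gradient form on polynomials -/

section GradForm

variable {d : ℕ}

/-- The form `(p, q) ↦ ∫ ⟪∇p, ∇q⟫ dμ` on polynomials, for a measure `μ` against which all gradients
of polynomials are square integrable. -/
noncomputable def gradForm (μ : Measure (Euc d))
    (hμ : ∀ q : MvPolynomial (Fin d) ℝ, MemLp (polyGrad q) 2 μ) :
    MvPolynomial (Fin d) ℝ →ₗ[ℝ] MvPolynomial (Fin d) ℝ →ₗ[ℝ] ℝ :=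
  LinearMap.mk₂ ℝ (fun p q => ∫ x, ⟪polyGrad p x, polyGrad q x⟫ ∂μ)
    (fun p p' q => by
      simp_rw [polyGrad_add, inner_add_left]
      exact integral_add (integrable_inner_of_memLp (hμ p) (hμ q))
        (integrable_inner_of_memLp (hμ p') (hμ q)))
    (fun c p q => by
      simp_rw [polyGrad_smul, real_inner_smul_left]
      exact integral_const_mul _ _)
    (fun p q q' => by
      simp_rw [polyGrad_add, inner_add_right]
      exact integral_add (integrable_inner_of_memLp (hμ p) (hμ q))
        (integrable_inner_of_memLp (hμ p) (hμ q')))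
    (fun c p q => by
      simp_rw [polyGrad_smul, real_inner_smul_right]
      exact integral_const_mul _ _)

lemma gradForm_apply (μ : Measure (Euc d))
    (hμ : ∀ q : MvPolynomial (Fin d) ℝ, MemLp (polyGrad q) 2 μ) (p q : MvPolynomial (Fin d) ℝ) :
    gradForm μ hμ p q = ∫ x, ⟪polyGrad p x, polyGrad q x⟫ ∂μ := rfl

variable {K : Triangulation d} {s : Finset (Euc d)}

/-- The form `a_T` on polynomials. -/
noncomputable def elementForm (s : Finset (Euc d)) :
    MvPolynomial (Fin d) ℝ →ₗ[ℝ] MvPolynomial (Fin d) ℝ →ₗ[ℝ] ℝ :=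
  gradForm (volume.restrict (openSimplex s)) fun q => memLp_openSimplex s (continuous_polyGrad q)

lemma aT_eq_elementForm {u v : Euc d → ℝ} {p q : MvPolynomial (Fin d) ℝ}
    (hu : ∀ x ∈ openSimplex s, u x = polyFun p x) (hv : ∀ x ∈ openSimplex s, v x = polyFun q x) :
    aT s u v = elementForm s p q := by
  refine integral_congr_ae ?_
  filter_upwards [weakGrad_ae_eq_polyGrad s hu, weakGrad_ae_eq_polyGrad s hv] with x h1 h2
  rw [h1, h2]

lemma elementForm_comm (p q : MvPolynomial (Fin d) ℝ) :
    elementForm s p q = elementForm s q p := by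
  simp_rw [elementForm, gradForm_apply, real_inner_comm]

lemma elementForm_self_nonneg (q : MvPolynomial (Fin d) ℝ) : 0 ≤ elementForm s q q :=
  integral_nonneg fun _ => real_inner_self_nonneg

/-- `a_T` is definite on polynomials of mean value zero: a vanishing gradient makes the polynomial
constant on the open simplex, and the constant is the mean value. -/
lemma eq_zero_of_elementForm_self_eq_zero (hs : s ∈ K.elements) {k : ℕ}
    {q : MvPolynomial (Fin d) ℝ} (hq : IsP0 k s q) (h : elementForm s q q = 0) : q = 0 := by
  have hopen := isOpen_openSimplex s
  have hne := openSimplex_nonempty hs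
  have hint : IntegrableOn (fun x => ⟪polyGrad q x, polyGrad q x⟫) (openSimplex s) :=
    integrable_inner_of_memLp (memLp_openSimplex s (continuous_polyGrad q))
      (memLp_openSimplex s (continuous_polyGrad q))
  have hae : (fun x => ⟪polyGrad q x, polyGrad q x⟫) =ᵐ[volume.restrict (openSimplex s)] 0 :=
    (setIntegral_eq_zero_iff_of_nonneg_ae
      (Eventually.of_forall fun _ => real_inner_self_nonneg) hint).1 h
  have hzero := Measure.eqOn_open_of_ae_eq hae hopen
    ((continuous_polyGrad q).inner (continuous_polyGrad q)).continuousOn continuousOn_const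
  obtain ⟨c, hc⟩ := hopen.exists_is_const_of_fderiv_eq_zero (𝕜 := ℝ) (f := polyFun q)
    (convex_openSimplex s).isPreconnected
    (fun x _ => (hasFDerivAt_polyFun q x).differentiableAt.differentiableWithinAt)
    (fun x hx => by
      ext w
      rw [fderiv_polyFun, inner_self_eq_zero.1 (hzero hx), inner_zero_left]
      rfl)
  have hconv : Convex ℝ (simplex s) := convex_convexHull ℝ _
  have hmean : ∫ x in openSimplex s, polyFun q x = 0 := by
    rw [← hq.2]
    refine setIntegral_congr_set ?_
    exact interior_ae_eq_of_null_frontier (hconv.addHaar_frontier volume)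
  rw [setIntegral_congr_fun hopen.measurableSet (g := fun _ => c) hc, setIntegral_const,
    smul_eq_mul] at hmean
  have hvol : (volume : Measure (Euc d)).real (openSimplex s) ≠ 0 :=
    (ENNReal.toReal_pos (hopen.measure_pos volume hne).ne'
      ((measure_mono (openSimplex_subset_simplex s)).trans_lt
        (isCompact_simplex s).measure_lt_top).ne).ne'
  have hc0 : c = 0 := (mul_eq_zero.1 hmean).resolve_left hvol
  exact eq_zero_of_polyFun_eqOn_zero hopen hne fun x hx => (hc x hx).trans hc0

lemma integrableOn_polyFun_simplex (s : Finset (Euc d)) (q : MvPolynomial (Fin d) ℝ) :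
    IntegrableOn (polyFun q) (simplex s) :=
  (continuous_polyFun q).continuousOn.integrableOn_compact (isCompact_simplex s)

/-- The space `𝒫₀ᵏ(T)`. -/
noncomputable def meanZeroPolys (k : ℕ) (s : Finset (Euc d)) :
    Submodule ℝ (MvPolynomial (Fin d) ℝ) where
  carrier := {q | IsP0 k s q}
  add_mem' {p q} hp hq := by
    refine ⟨(MvPolynomial.totalDegree_add p q).trans (max_le hp.1 hq.1), ?_⟩
    simp_rw [polyFun_add]
    rw [integral_add (integrableOn_polyFun_simplex s p) (integrableOn_polyFun_simplex s q),
      hp.2, hq.2, add_zero]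
  zero_mem' := by simp [IsP0, polyFun]
  smul_mem' c q hq := by
    refine ⟨(MvPolynomial.totalDegree_smul_le c q).trans hq.1, ?_⟩
    simp_rw [polyFun_smul]
    rw [integral_const_mul, hq.2, mul_zero]

instance finiteDimensional_meanZeroPolys (k : ℕ) (s : Finset (Euc d)) :
    FiniteDimensional ℝ (meanZeroPolys k s) := by
  have hle : meanZeroPolys k s ≤ MvPolynomial.restrictTotalDegree (Fin d) ℝ k := fun q hq =>
    (MvPolynomial.mem_restrictTotalDegree _ _ _).2 hq.1
  exact Submodule.finiteDimensional_of_le hle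

end GradForm

/-! ### The trace inverse inequality -/

section TraceInverse

variable {d : ℕ} {K : Triangulation d} {s : Finset (Euc d)}

lemma memLp_restrict_of_subset_facet {E : Type*} [NormedAddCommGroup E] {f : Euc d → E}
    (hf : MemLp f 2 ((surfaceMeasure d).restrict (simplexBoundary s))) {p : Euc d} (hp : p ∈ s)
    {A : Set (Euc d)} (hA : A ⊆ facet s p) : MemLp f 2 ((surfaceMeasure d).restrict A) :=
  hf.mono_measure
    (Measure.restrict_mono (hA.trans (facet_subset_simplexBoundary hp)) le_rfl)

lemma gradWholeBdrySqT_eq (hd : 1 ≤ d) (hs : s ∈ K.elements) {u : Euc d → ℝ}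
    {q : MvPolynomial (Fin d) ℝ} (hu : ∀ x ∈ openSimplex s, u x = polyFun q x) :
    gradWholeBdrySqT s u
      = ∑ p ∈ s, ∫ x in facet s p, ‖polyGrad q x‖ ^ 2 ∂(surfaceMeasure d) := by
  refine Finset.sum_congr rfl fun p hp => integral_congr_ae ?_
  filter_upwards [ae_mono (Measure.restrict_mono (facet_subset_simplexBoundary hp) le_rfl)
    (gradTrace_ae_eq_polyGrad hd hs hu)] with x hx
  rw [hx]

/-- On one element, the boundary norm of the gradient of a polynomial is bounded by its element norm
because both are quadratic forms on a finite-dimensional space, and the second one is definite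
modulo constants. -/
lemma exists_trace_inverse_element (hd : 1 ≤ d) (hs : s ∈ K.elements) (k : ℕ) (h : ℝ) :
    ∃ C : ℝ, 0 ≤ C ∧ ∀ q : MvPolynomial (Fin d) ℝ, q.totalDegree ≤ k →
      h * gradWholeBdrySqT s (polyFun q) ≤ C * aT s (polyFun q) (polyFun q) := by
  have hmem : ∀ p : s, ∀ q : MvPolynomial (Fin d) ℝ,
      MemLp (polyGrad q) 2 ((surfaceMeasure d).restrict (facet s p)) := fun p q =>
    memLp_restrict_of_subset_facet (memLp_simplexBoundary hd hs (continuous_polyGrad q)) p.2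
      subset_rfl
  set V := meanZeroPolys k s
  obtain ⟨C, hC0, hC⟩ := exists_forall_le_mul_of_posDef
    ((elementForm s).domRestrict₁₂ V V)
    ((h • ∑ p : s, gradForm _ (hmem p)).domRestrict₁₂ V V)
    (fun x y => elementForm_comm _ _) (fun x => elementForm_self_nonneg _)
    (fun x hx => Subtype.ext (eq_zero_of_elementForm_self_eq_zero hs x.2 hx))
  refine ⟨C, hC0, fun q hq => ?_⟩
  rw [gradWholeBdrySqT_eq hd hs (fun _ _ => rfl), aT_eq_elementForm (fun _ _ => rfl) fun _ _ => rfl]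
  -- Subtracting the mean value changes neither side.
  set m : ℝ := (∫ x in simplex s, polyFun q x) / volume.real (simplex s)
  have hvol : (volume : Measure (Euc d)).real (simplex s) ≠ 0 := by
    refine (ENNReal.toReal_pos ?_ (isCompact_simplex s).measure_lt_top.ne).ne'
    exact (((isOpen_openSimplex s).measure_pos volume (openSimplex_nonempty hs)).trans_le
      (measure_mono (openSimplex_subset_simplex s))).ne'
  have hq0 : q - MvPolynomial.C m ∈ V := by
    refine ⟨(MvPolynomial.totalDegree_sub_C_le q m).trans hq, ?_⟩
    have : ∀ x : Euc d, polyFun (q - MvPolynomial.C m) x = polyFun q x - m := by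
      intro x; simp [polyFun]
    simp_rw [this]
    have hm : IntegrableOn (fun _ : Euc d => m) (simplex s) :=
      continuousOn_const.integrableOn_compact (isCompact_simplex s)
    rw [integral_sub (integrableOn_polyFun_simplex s q) hm, setIntegral_const, smul_eq_mul,
      mul_div_cancel₀ _ hvol, sub_self]
  have hgrad : polyGrad (q - MvPolynomial.C m) = polyGrad q := by
    ext x i; simp [polyGrad]
  have := hC ⟨_, hq0⟩
  simp only [LinearMap.domRestrict₁₂_apply, LinearMap.smul_apply, LinearMap.sum_apply,
    elementForm, gradForm_apply, hgrad, smul_eq_mul, real_inner_self_eq_norm_sq] at this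
  rw [Finset.univ_eq_attach, Finset.sum_attach s
    (fun p => ∫ x in facet s p, ‖polyGrad q x‖ ^ 2 ∂(surfaceMeasure d))] at this
  simpa only [elementForm, gradForm_apply, real_inner_self_eq_norm_sq] using this

lemma traceInvConst_nonneg (K : Triangulation d) (k : ℕ) (h : ℝ) : 0 ≤ traceInvConst K k h :=
  Real.sInf_nonneg fun _ hc => hc.1

lemma aT_self_nonneg (s : Finset (Euc d)) (u : Euc d → ℝ) : 0 ≤ aT s u u :=
  integral_nonneg fun _ => real_inner_self_nonneg

/-- The infimum that defines the trace inverse constant is attained: the set of admissible constants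
is closed, and it is nonempty since the mesh is finite. -/
lemma trace_inverse (hd : 1 ≤ d) (hs : s ∈ K.elements) {k : ℕ} (h : ℝ)
    {q : MvPolynomial (Fin d) ℝ} (hq : q.totalDegree ≤ k) :
    h * gradWholeBdrySqT s (polyFun q) ≤ traceInvConst K k h * aT s (polyFun q) (polyFun q) := by
  set S : Set ℝ := {c : ℝ | 0 ≤ c ∧ ∀ s ∈ K.elements, ∀ q : MvPolynomial (Fin d) ℝ,
    q.totalDegree ≤ k → h * gradWholeBdrySqT s (polyFun q) ≤ c * aT s (polyFun q) (polyFun q)}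
    with hS
  have hclosed : IsClosed S := by
    simp only [hS, ofPred_and, ofPred_forall]
    refine isClosed_Ici.inter (isClosed_iInter fun s => isClosed_iInter fun _ =>
      isClosed_iInter fun q => isClosed_iInter fun _ => ?_)
    exact isClosed_le continuous_const (continuous_id.mul continuous_const)
  have hne : S.Nonempty := by
    choose! C hC0 hC using fun s (hs : s ∈ K.elements) =>
      exists_trace_inverse_element hd hs k h
    refine ⟨∑ s ∈ K.elements, C s, Finset.sum_nonneg hC0, fun s hs q hq => ?_⟩
    exact (hC s hs q hq).trans (mul_le_mul_of_nonneg_right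
      (Finset.single_le_sum hC0 hs) (aT_self_nonneg _ _))
  have hbdd : BddBelow S := ⟨0, fun c hc => hc.1⟩
  exact (hclosed.csInf_mem hne hbdd).2 s hs q hq

end TraceInverse

/-! ### Bounds for the bilinear forms -/

section FormBounds

variable {d : ℕ} {K : Triangulation d} {s : Finset (Euc d)}

lemma norm_outerNormal_le_one (s : Finset (Euc d)) (p : Euc d) : ‖outerNormal s p‖ ≤ 1 := by
  rw [outerNormal]
  by_cases h : (vectorSpan ℝ ((s : Set (Euc d)) \ {p}))ᗮ.starProjection (s.centroid ℝ id - p) = 0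
  · simp [h]
  · exact (NormedSpace.norm_normalize h).le

lemma bdryT_self_nonneg (K : Triangulation d) (s : Finset (Euc d)) (u : Euc d → ℝ) :
    0 ≤ bdryT K s u u :=
  Finset.sum_nonneg fun _ _ => integral_nonneg fun _ => mul_self_nonneg _

lemma gradBdrySqT_nonneg (K : Triangulation d) (s : Finset (Euc d)) (u : Euc d → ℝ) :
    0 ≤ gradBdrySqT K s u :=
  Finset.sum_nonneg fun _ _ => integral_nonneg fun _ => sq_nonneg _

lemma gradBdrySqT_le_gradWholeBdrySqT (K : Triangulation d) (s : Finset (Euc d))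
    (u : Euc d → ℝ) : gradBdrySqT K s u ≤ gradWholeBdrySqT s u := by
  refine Finset.sum_le_sum fun p hp => setIntegral_mono_set ?_
    (Eventually.of_forall fun _ => sq_nonneg _) inter_subset_left.eventuallyLE
  exact (memLp_restrict_of_subset_facet (memLp_gradTrace s u) hp subset_rfl).integrable_norm_pow
    (by norm_num)

lemma abs_aT_le (s : Finset (Euc d)) (u v : Euc d → ℝ) :
    |aT s u v| ≤ √(aT s u u) * √(aT s v v) := by
  simpa only [aT, real_inner_self_eq_norm_sq] using
    abs_integral_inner_le (memLp_weakGrad (openSimplex s) u) (memLp_weakGrad (openSimplex s) v)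

lemma abs_bdryT_le (K : Triangulation d) (s : Finset (Euc d)) (u v : Euc d → ℝ) :
    |bdryT K s u v| ≤ √(bdryT K s u u) * √(bdryT K s v v) := by
  refine abs_sum_le_sqrt_mul_sqrt s (fun _ _ => integral_nonneg fun _ => mul_self_nonneg _)
    (fun _ _ => integral_nonneg fun _ => mul_self_nonneg _) fun p hp => ?_
  simpa only [sq] using abs_integral_mul_le
    (memLp_restrict_of_subset_facet (memLp_trace s u) hp inter_subset_left)
    (memLp_restrict_of_subset_facet (memLp_trace s v) hp inter_subset_left)

lemma abs_NcT_le (K : Triangulation d) (s : Finset (Euc d)) (u v : Euc d → ℝ) :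
    |NcT K s u v| ≤ √(gradBdrySqT K s u) * √(bdryT K s v v) := by
  refine abs_sum_le_sqrt_mul_sqrt s (fun _ _ => integral_nonneg fun _ => sq_nonneg _)
    (fun _ _ => integral_nonneg fun _ => mul_self_nonneg _) fun p hp => ?_
  have hG := memLp_restrict_of_subset_facet (memLp_gradTrace s u) hp
    (inter_subset_left (t := frontier K.domain))
  have hn : MemLp (fun x => -⟪gradTrace s u x, outerNormal s p⟫) 2
      ((surfaceMeasure d).restrict (facet s p ∩ frontier K.domain)) := (hG.inner_const _).neg
  refine (abs_integral_mul_le hn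
    (memLp_restrict_of_subset_facet (memLp_trace s v) hp inter_subset_left)).trans ?_
  simp_rw [← sq]
  refine mul_le_mul_of_nonneg_right (Real.sqrt_le_sqrt ?_) (Real.sqrt_nonneg _)
  refine integral_mono hn.integrable_sq (hG.integrable_norm_pow (by norm_num)) fun x => ?_
  have h1 : |⟪gradTrace s u x, outerNormal s p⟫| ≤ ‖gradTrace s u x‖ :=
    (abs_real_inner_le_norm _ _).trans
      (mul_le_of_le_one_right (norm_nonneg _) (norm_outerNormal_le_one s p))
  simpa only [neg_sq, sq_abs] using pow_le_pow_left₀ (abs_nonneg _) h1 2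

lemma aForm_self_nonneg (K : Triangulation d) (u : Euc d → ℝ) : 0 ≤ aForm K u u :=
  Finset.sum_nonneg fun _ _ => aT_self_nonneg _ _

lemma bdry_self_nonneg (K : Triangulation d) (u : Euc d → ℝ) : 0 ≤ bdry K u u :=
  Finset.sum_nonneg fun _ _ => bdryT_self_nonneg _ _ _

lemma gradBdrySq_nonneg (K : Triangulation d) (u : Euc d → ℝ) : 0 ≤ gradBdrySq K u :=
  Finset.sum_nonneg fun _ _ => gradBdrySqT_nonneg _ _ _

lemma abs_aForm_le (K : Triangulation d) (u v : Euc d → ℝ) :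
    |aForm K u v| ≤ √(aForm K u u) * √(aForm K v v) :=
  abs_sum_le_sqrt_mul_sqrt _ (fun _ _ => aT_self_nonneg _ _) (fun _ _ => aT_self_nonneg _ _)
    fun _ _ => abs_aT_le _ _ _

lemma abs_bdry_le (K : Triangulation d) (u v : Euc d → ℝ) :
    |bdry K u v| ≤ √(bdry K u u) * √(bdry K v v) :=
  abs_sum_le_sqrt_mul_sqrt _ (fun _ _ => bdryT_self_nonneg _ _ _)
    (fun _ _ => bdryT_self_nonneg _ _ _) fun _ _ => abs_bdryT_le _ _ _ _

lemma abs_Nc_le (K : Triangulation d) (u v : Euc d → ℝ) :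
    |Nc K u v| ≤ √(gradBdrySq K u) * √(bdry K v v) :=
  abs_sum_le_sqrt_mul_sqrt _ (fun _ _ => gradBdrySqT_nonneg _ _ _)
    (fun _ _ => bdryT_self_nonneg _ _ _) fun _ _ => abs_NcT_le _ _ _ _

lemma penalty_self_nonneg (K : Triangulation d) {h : ℝ} (hh : 0 < h) (u : Euc d → ℝ) :
    0 ≤ penalty K h u u :=
  mul_nonneg (by positivity) (bdry_self_nonneg K u)

lemma abs_penalty_le (K : Triangulation d) {h : ℝ} (hh : 0 < h) (u v : Euc d → ℝ) :
    |penalty K h u v| ≤ √(penalty K h u u) * √(penalty K h v v) := by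
  have h0 : 0 ≤ 1 / h := by positivity
  simp only [penalty]
  rw [abs_mul, abs_of_nonneg h0, Real.sqrt_mul h0, Real.sqrt_mul h0, mul_mul_mul_comm,
    Real.mul_self_sqrt h0]
  exact mul_le_mul_of_nonneg_left (abs_bdry_le K u v) h0

/-- The weights `h` and `h⁻¹` cancel in the consistency term. -/
lemma abs_Nc_le_weighted (K : Triangulation d) {h : ℝ} (hh : 0 < h) (u v : Euc d → ℝ) :
    |Nc K u v| ≤ √(h * gradBdrySq K u) * √(penalty K h v v) := by
  have h1 : √h * √(1 / h) = 1 := by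
    rw [← Real.sqrt_mul hh.le, mul_one_div_cancel hh.ne', Real.sqrt_one]
  rw [penalty, Real.sqrt_mul hh.le, Real.sqrt_mul (by positivity), mul_mul_mul_comm, h1, one_mul]
  exact abs_Nc_le K u v

end FormBounds

/-! ### The lifting -/

section Lifting

variable {d : ℕ} {K : Triangulation d} {s : Finset (Euc d)}

/-- On polynomials `v`, the consistency term `N^c_T(v, u)` is a linear functional of `v`, because
the trace of `∇v` agrees almost everywhere with the classical gradient. -/
lemma exists_linearMap_eq_NcT (hd : 1 ≤ d) (hs : s ∈ K.elements) (u : Euc d → ℝ) :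
    ∃ l : MvPolynomial (Fin d) ℝ →ₗ[ℝ] ℝ, ∀ v, l v = NcT K s (polyFun v) u := by
  set I : MvPolynomial (Fin d) ℝ → Euc d → Euc d → ℝ := fun v p x =>
    (-⟪polyGrad v x, outerNormal s p⟫) * trace s u x with hI
  have hNc : ∀ v, NcT K s (polyFun v) u
      = ∑ p ∈ s, ∫ x in facet s p ∩ frontier K.domain, I v p x ∂(surfaceMeasure d) := by
    refine fun v => Finset.sum_congr rfl fun p hp => integral_congr_ae ?_
    filter_upwards [ae_mono (Measure.restrict_mono
      (inter_subset_left.trans (facet_subset_simplexBoundary hp)) le_rfl)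
      (gradTrace_ae_eq_polyGrad hd hs (u := polyFun v) fun _ _ => rfl)] with x hx
    rw [hx]
  have hint : ∀ v, ∀ p ∈ s, Integrable (I v p)
      ((surfaceMeasure d).restrict (facet s p ∩ frontier K.domain)) := by
    intro v p hp
    have hG := memLp_restrict_of_subset_facet
      (memLp_simplexBoundary hd hs (continuous_polyGrad v)) hp
      (inter_subset_left (t := frontier K.domain))
    exact (hG.inner_const (outerNormal s p)).neg.integrable_mul
      (memLp_restrict_of_subset_facet (memLp_trace s u) hp inter_subset_left)
  refine ⟨{ toFun := fun v => NcT K s (polyFun v) u, map_add' := ?_, map_smul' := ?_ },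
    fun v => rfl⟩
  · intro v w
    rw [hNc, hNc, hNc, ← Finset.sum_add_distrib]
    refine Finset.sum_congr rfl fun p hp => ?_
    rw [← integral_add (hint v p hp) (hint w p hp)]
    refine integral_congr_ae (Eventually.of_forall fun x => ?_)
    simp only [hI, polyGrad_add, inner_add_left]
    ring
  · intro c v
    rw [hNc, hNc, RingHom.id_apply, smul_eq_mul, Finset.mul_sum]
    refine Finset.sum_congr rfl fun p hp => ?_
    rw [← integral_const_mul]
    refine integral_congr_ae (Eventually.of_forall fun x => ?_)
    simp only [hI, polyGrad_smul, real_inner_smul_left]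
    ring

/-- The local problem is uniquely solvable, since `a_T` is definite on the finite-dimensional space
`𝒫₀ᵏ(T)`. -/
lemma existsUnique_isLocalLifting (hd : 1 ≤ d) (hs : s ∈ K.elements) (k : ℕ) (u : Euc d → ℝ) :
    ∃! q : MvPolynomial (Fin d) ℝ, IsLocalLifting K k s u q := by
  obtain ⟨l, hl⟩ := exists_linearMap_eq_NcT hd hs u
  set V := meanZeroPolys k s
  have haT : ∀ p q : MvPolynomial (Fin d) ℝ,
      aT s (polyFun p) (polyFun q) = elementForm s p q := fun p q =>
    aT_eq_elementForm (fun _ _ => rfl) fun _ _ => rfl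
  obtain ⟨q, hq, huniq⟩ := existsUnique_forall_eq_of_definite
    ((elementForm s).domRestrict₁₂ V V)
    (fun x hx => Subtype.ext (eq_zero_of_elementForm_self_eq_zero hs x.2 hx)) (l.domRestrict V)
  refine ⟨q, ⟨q.2, fun v hv => ?_⟩, fun r hr => ?_⟩
  · rw [haT, ← hl]
    exact hq ⟨v, hv⟩
  · refine congrArg Subtype.val (huniq ⟨r, hr.1⟩ fun v => ?_)
    have := hr.2 v v.2
    rwa [haT, ← hl] at this

lemma isLocalLifting_localLifting (hd : 1 ≤ d) (hs : s ∈ K.elements) (k : ℕ) (u : Euc d → ℝ) :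
    IsLocalLifting K k s u (localLifting K k s u) := by
  have hex := (existsUnique_isLocalLifting hd hs k u).exists
  rw [localLifting, dif_pos hex]
  exact hex.choose_spec

lemma lifting_eq_localLifting (hs : s ∈ K.elements) (k : ℕ) (u : Euc d → ℝ) {x : Euc d}
    (hx : x ∈ openSimplex s) : lifting K k u x = polyFun (localLifting K k s u) x := by
  rw [lifting, Finset.sum_eq_single_of_mem s hs, indicator_of_mem hx]
  intro t ht hts
  exact indicator_of_notMem
    (fun hxt => (disjoint_left.1 (disjoint_openSimplex ht hs hts)) hxt hx) _

/-- Testing the local problem with its solution `q` gives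
`‖∇q‖²_T = N^c_T(q, u) ≤ ‖∇q‖_{∂T} ‖u‖_{T ∩ ∂Ω}`, and the trace inverse inequality bounds the first
factor by `‖∇q‖_T`. -/
lemma aT_lifting_le (hd : 1 ≤ d) (hs : s ∈ K.elements) (k : ℕ) {h : ℝ} (hh : 0 < h)
    (u : Euc d → ℝ) :
    aT s (lifting K k u) (lifting K k u) ≤ traceInvConst K k h / h * bdryT K s u u := by
  set q := localLifting K k s u
  have hq : IsLocalLifting K k s u q := isLocalLifting_localLifting hd hs k u
  have hLq : aT s (lifting K k u) (lifting K k u) = aT s (polyFun q) (polyFun q) := by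
    rw [aT_eq_elementForm (fun x hx => lifting_eq_localLifting hs k u hx)
      fun x hx => lifting_eq_localLifting hs k u hx,
      aT_eq_elementForm (fun _ _ => rfl) fun _ _ => rfl]
  rw [hLq]
  set a := aT s (polyFun q) (polyFun q)
  set c := traceInvConst K k h
  have ha : 0 ≤ a := aT_self_nonneg _ _
  have hb : 0 ≤ bdryT K s u u := bdryT_self_nonneg _ _ _
  have hc : 0 ≤ c := traceInvConst_nonneg K k h
  have hg : gradBdrySqT K s (polyFun q) ≤ c / h * a := by
    rw [div_mul_eq_mul_div, le_div_iff₀' hh]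
    exact (mul_le_mul_of_nonneg_left (gradBdrySqT_le_gradWholeBdrySqT K s _) hh.le).trans
      (trace_inverse hd hs h hq.1.1)
  have h1 : a ≤ √(c / h * a) * √(bdryT K s u u) := calc
    a = NcT K s (polyFun q) u := hq.2 q hq.1
    _ ≤ |NcT K s (polyFun q) u| := le_abs_self _
    _ ≤ √(gradBdrySqT K s (polyFun q)) * √(bdryT K s u u) := abs_NcT_le _ _ _ _
    _ ≤ √(c / h * a) * √(bdryT K s u u) :=
      mul_le_mul_of_nonneg_right (Real.sqrt_le_sqrt hg) (Real.sqrt_nonneg _)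
  have h2 : a * a ≤ a * (c / h * bdryT K s u u) := by
    have h3 := mul_self_le_mul_self ha h1
    rw [mul_mul_mul_comm, Real.mul_self_sqrt (by positivity), Real.mul_self_sqrt hb] at h3
    linarith
  rcases ha.eq_or_lt with h0 | h0
  · rw [← h0]; positivity
  · exact le_of_mul_le_mul_left h2 h0

lemma aForm_lifting_le (hd : 1 ≤ d) (K : Triangulation d) (k : ℕ) {h : ℝ} (hh : 0 < h)
    (u : Euc d → ℝ) :
    aForm K (lifting K k u) (lifting K k u) ≤ traceInvConst K k h / h * bdry K u u := by
  rw [aForm, bdry, Finset.mul_sum]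
  exact Finset.sum_le_sum fun s hs => aT_lifting_le hd hs k hh u

lemma aForm_lifting_le_penalty (hd : 1 ≤ d) (K : Triangulation d) (k : ℕ) {h : ℝ} (hh : 0 < h)
    (u : Euc d → ℝ) :
    aForm K (lifting K k u) (lifting K k u) ≤ traceInvConst K k h * penalty K h u u := by
  refine (aForm_lifting_le hd K k hh u).trans_eq ?_
  rw [penalty]; ring

end Lifting

/-! ### Norm equivalence and continuity -/

section Norms

variable {d : ℕ} {K : Triangulation d} {k : ℕ} {h : ℝ}

lemma gradBdrySq_le_of_memVh (hd : 1 ≤ d) (hh : 0 < h) {v : Euc d → ℝ} (hv : MemVh K k v) :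
    h * gradBdrySq K v ≤ traceInvConst K k h * aForm K v v := by
  rw [gradBdrySq, aForm, Finset.mul_sum, Finset.mul_sum]
  refine Finset.sum_le_sum fun s hs => ?_
  obtain ⟨q, hq, hvq⟩ := hv.2 s hs
  have hvq' : ∀ x ∈ openSimplex s, v x = polyFun q x := fun x hx =>
    hvq x (openSimplex_subset_simplex s hx)
  refine (mul_le_mul_of_nonneg_left (gradBdrySqT_le_gradWholeBdrySqT K s v) hh.le).trans ?_
  have := trace_inverse hd hs h hq
  rwa [gradWholeBdrySqT_eq hd hs fun _ _ => rfl, ← gradWholeBdrySqT_eq hd hs hvq',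
    aT_eq_elementForm (fun _ _ => rfl) fun _ _ => rfl, ← aT_eq_elementForm hvq' hvq'] at this

/-- Both admissible stabilizations dominate the penalty form and are dominated by the modified
stabilization. -/
lemma penalty_le_and_le_modifiedStab {Ns : (Euc d → ℝ) → (Euc d → ℝ) → ℝ}
    (hNs : Ns = modifiedStab K k h ∨ Ns = penalty K h) (v : Euc d → ℝ) :
    penalty K h v v ≤ Ns v v ∧ Ns v v ≤ modifiedStab K k h v v := by
  have h0 := aForm_self_nonneg K (lifting K k v)
  rcases hNs with rfl | rfl <;> simp only [modifiedStab] <;> constructor <;> linarith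

lemma normStrong_eq (hh : 0 < h) {Ns : (Euc d → ℝ) → (Euc d → ℝ) → ℝ}
    (hNs : Ns = modifiedStab K k h ∨ Ns = penalty K h) (v : Euc d → ℝ) :
    normStrong K h Ns v = √(aForm K v v + Ns v v + h * gradBdrySq K v) := by
  have h1 := aForm_self_nonneg K v
  have h2 := penalty_self_nonneg K hh v
  have h3 := (penalty_le_and_le_modifiedStab hNs v).1
  rw [normStrong, normA, Real.sq_sqrt (by linarith)]

lemma normA_modifiedStab_le_normStrong (hd : 1 ≤ d) (hh : 0 < h)
    {Ns : (Euc d → ℝ) → (Euc d → ℝ) → ℝ}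
    (hNs : Ns = modifiedStab K k h ∨ Ns = penalty K h) (v : Euc d → ℝ) :
    normA K (modifiedStab K k h) v
      ≤ √(1 + 2 * traceInvConst K k h) * normStrong K h Ns v := by
  have hc := traceInvConst_nonneg K k h
  rw [normStrong_eq hh hNs, normA, ← Real.sqrt_mul (by positivity)]
  refine Real.sqrt_le_sqrt ?_
  have h1 := aForm_self_nonneg K v
  have h2 := penalty_self_nonneg K hh v
  have h3 := (penalty_le_and_le_modifiedStab hNs v).1
  have h4 := mul_nonneg hh.le (gradBdrySq_nonneg K v)
  have h5 := aForm_lifting_le_penalty hd K k hh v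
  have h6 := mul_nonneg hc (by linarith :
    0 ≤ aForm K v v + (Ns v v - penalty K h v v) + h * gradBdrySq K v)
  simp only [modifiedStab]
  linarith

lemma normStrong_le_normA_modifiedStab (hd : 1 ≤ d) (hh : 0 < h)
    {Ns : (Euc d → ℝ) → (Euc d → ℝ) → ℝ}
    (hNs : Ns = modifiedStab K k h ∨ Ns = penalty K h) {v : Euc d → ℝ} (hv : MemVh K k v) :
    normStrong K h Ns v
      ≤ √(1 + traceInvConst K k h) * normA K (modifiedStab K k h) v := by
  have hc := traceInvConst_nonneg K k h
  rw [normStrong_eq hh hNs, normA, ← Real.sqrt_mul (by positivity)]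
  refine Real.sqrt_le_sqrt ?_
  have h2 := penalty_self_nonneg K hh v
  obtain ⟨h3, h3'⟩ := penalty_le_and_le_modifiedStab hNs v
  have h4 := gradBdrySq_le_of_memVh hd hh hv
  have h5 := mul_nonneg hc (by linarith : 0 ≤ modifiedStab K k h v v)
  linarith

/-- Each of the terms of `A*` is bounded separately by the Cauchy-Schwarz inequality, since weak
gradients and traces are square integrable. -/
lemma abs_Astar_le (hd : 1 ≤ d) (hh : 0 < h) {Ns : (Euc d → ℝ) → (Euc d → ℝ) → ℝ}
    (hNs : Ns = modifiedStab K k h ∨ Ns = penalty K h) (u v : Euc d → ℝ) :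
    |Astar K k h u v|
      ≤ (4 + 2 * traceInvConst K k h) * (normStrong K h Ns u * normStrong K h Ns v) := by
  set c := traceInvConst K k h
  have hc : 0 ≤ c := traceInvConst_nonneg K k h
  have hS : ∀ w, √(aForm K w w) ≤ normStrong K h Ns w ∧
      √(penalty K h w w) ≤ normStrong K h Ns w ∧
      √(h * gradBdrySq K w) ≤ normStrong K h Ns w := by
    intro w
    have h1 := aForm_self_nonneg K w
    have h2 := penalty_self_nonneg K hh w
    have h3 := (penalty_le_and_le_modifiedStab hNs w).1
    have h4 := mul_nonneg hh.le (gradBdrySq_nonneg K w)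
    rw [normStrong_eq hh hNs]
    exact ⟨Real.sqrt_le_sqrt (by linarith), Real.sqrt_le_sqrt (by linarith),
      Real.sqrt_le_sqrt (by linarith)⟩
  have hmul : ∀ {x y X Y : ℝ}, √x ≤ X → √y ≤ Y → √x * √y ≤ X * Y := fun hx hy =>
    mul_le_mul hx hy (Real.sqrt_nonneg _) ((Real.sqrt_nonneg _).trans hx)
  obtain ⟨ua, up, ug⟩ := hS u
  obtain ⟨va, vp, vg⟩ := hS v
  set P := normStrong K h Ns u * normStrong K h Ns v with hP
  have t1 : |aForm K u v| ≤ P := (abs_aForm_le K u v).trans (hmul ua va)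
  have t2 : |Nc K u v| ≤ P := (abs_Nc_le_weighted K hh u v).trans (hmul ug vp)
  have t3 : |Nc K v u| ≤ P := by
    rw [hP, mul_comm]
    exact (abs_Nc_le_weighted K hh v u).trans (hmul vg up)
  have t4 : |penalty K h u v| ≤ P := (abs_penalty_le K hh u v).trans (hmul up vp)
  have t5 : |aForm K (lifting K k u) (lifting K k v)| ≤ c * P := by
    refine (abs_aForm_le K _ _).trans ?_
    refine (mul_le_mul (Real.sqrt_le_sqrt (aForm_lifting_le_penalty hd K k hh u))
      (Real.sqrt_le_sqrt (aForm_lifting_le_penalty hd K k hh v)) (Real.sqrt_nonneg _)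
      (Real.sqrt_nonneg _)).trans ?_
    rw [Real.sqrt_mul hc, Real.sqrt_mul hc, mul_mul_mul_comm, Real.mul_self_sqrt hc]
    exact mul_le_mul_of_nonneg_left (hmul up vp) hc
  rw [Astar, modifiedStab]
  rw [abs_le] at *
  constructor <;> linarith [t1.1, t1.2, t2.1, t2.2, t3.1, t3.2, t4.1, t4.2, t5.1, t5.2]

end Norms

end Nitsche

theorem mainTheorem3 :
    -- The lifting is well defined and satisfies the estimate, elementwise and globally.
    (∀ (d : ℕ), 1 ≤ d → ∀ (K : Nitsche.Triangulation d) (k : ℕ) (h : ℝ), 0 < h →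
      ∀ u : Nitsche.Euc d → ℝ, Nitsche.MemH1 K.domain u →
        (∀ s ∈ K.elements, ∃! q : MvPolynomial (Fin d) ℝ, Nitsche.IsLocalLifting K k s u q) ∧
        (∀ s ∈ K.elements,
          Nitsche.aT s (Nitsche.lifting K k u) (Nitsche.lifting K k u)
            ≤ Nitsche.traceInvConst K k h / h * Nitsche.bdryT K s u u) ∧
        Nitsche.aForm K (Nitsche.lifting K k u) (Nitsche.lifting K k u)
          ≤ Nitsche.traceInvConst K k h / h * Nitsche.bdry K u u) ∧
    -- Norm equivalence and continuity, with a constant that depends on `c_tr` only. The strong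
    -- norm may be built with the modified stabilization or with the penalty form alone.
    (∃ C : ℝ → ℝ, Monotone C ∧
      ∀ (d : ℕ), 1 ≤ d → ∀ (K : Nitsche.Triangulation d) (k : ℕ) (h : ℝ), 0 < h →
      ∀ Ns : (Nitsche.Euc d → ℝ) → (Nitsche.Euc d → ℝ) → ℝ,
        Ns = Nitsche.modifiedStab K k h ∨ Ns = Nitsche.penalty K h →
        (∀ v : Nitsche.Euc d → ℝ, Nitsche.MemVh K k v →
          Nitsche.normA K (Nitsche.modifiedStab K k h) v
              ≤ C (Nitsche.traceInvConst K k h) * Nitsche.normStrong K h Ns v ∧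
          Nitsche.normStrong K h Ns v
              ≤ C (Nitsche.traceInvConst K k h)
                * Nitsche.normA K (Nitsche.modifiedStab K k h) v) ∧
        (∀ u v : Nitsche.Euc d → ℝ, Nitsche.MemVhAddH2 K k u → Nitsche.MemVhAddH2 K k v →
          |Nitsche.Astar K k h u v|
            ≤ C (Nitsche.traceInvConst K k h)
              * (Nitsche.normStrong K h Ns u * Nitsche.normStrong K h Ns v))) := by
  refine ⟨fun d hd K k h hh u _ => ⟨fun s hs => Nitsche.existsUnique_isLocalLifting hd hs k u,
    fun s hs => Nitsche.aT_lifting_le hd hs k hh u, Nitsche.aForm_lifting_le hd K k hh u⟩,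
    fun c => 4 + 2 * c, fun a b hab => by dsimp only; linarith, ?_⟩
  intro d hd K k h hh Ns hNs
  have hc := Nitsche.traceInvConst_nonneg K k h
  -- A number that is at least `1` is at least its own square root.
  have hsqrt : ∀ {x : ℝ}, 1 ≤ x → x ≤ 4 + 2 * Nitsche.traceInvConst K k h →
      √x ≤ 4 + 2 * Nitsche.traceInvConst K k h := fun h1 h2 =>
    (Real.sqrt_le_sqrt (by nlinarith)).trans
      ((Real.sqrt_sq (zero_le_one.trans h1)).le.trans h2)
  refine ⟨fun v hv => ⟨?_, ?_⟩, fun u v _ _ => Nitsche.abs_Astar_le hd hh hNs u v⟩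
  · exact (Nitsche.normA_modifiedStab_le_normStrong hd hh hNs v).trans
      (mul_le_mul_of_nonneg_right (hsqrt (by linarith) (by linarith)) (Real.sqrt_nonneg _))
  · exact (Nitsche.normStrong_le_normA_modifiedStab hd hh hNs hv).trans
      (mul_le_mul_of_nonneg_right (hsqrt (by linarith) (by linarith)) (Real.sqrt_nonneg _))
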